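/- Let $(X^*,\Phi,X_*,\Phi^\vee)$ be a reduced root datum with finite root set, with a base $\Delta$, positive roots $\Phi^+$, negative roots $\Phi^-=-\Phi^+$ and height function $\mathrm{ht}$; put $h=1+\max_{\gamma\in\Phi}\mathrm{ht}(\gamma)$ (the Coxeter number if $\Phi$ is irreducible) and let $p$ be a prime with $p>h+1$. Let $\mathcal A$ be the ring of non-commutative formal power series over $\mathbb Z_p$ in the variables $V_\alpha$ ($\alpha\in\Phi^+$), $W_\delta$ ($\delta\in\Delta$), $U_\beta$ ($\beta\in\Phi^-$), with the topology of coefficientwise convergence; for a variable $X$ and $a\in\mathbb Z_p$ put $(1+X)^a=\sum_{m\ge0}\binom am X^m$. Fix integers $c_{ij}=c_{ij}(\gamma,\gamma')$ for $\gamma,\gamma'\in\Phi$, $i,j>0$, and integers $n_\delta=n_\delta(\alpha)\ge 0$ (for the pro-$p$ Iwahori subgroup of a split reductive group over $\mathbb Q_p$ with this root datum these are the constants in $x_\gamma(t)x_{\gamma'}(u)=\prod x_{i\gamma+j\gamma'}(c_{ij}t^iu^j)\,x_{\gamma'}(u)x_\gamma(t)$ and $h_\alpha(t)=\prod_\delta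 h_\delta(t)^{n_\delta}$; the statement holds for any integers), and fix the order of the factors in the products below. Let $\mathcal R\subset\mathcal A$ be the closed two-sided ideal generated by the relations - (R-1) $(1+W_{\delta_1})(1+W_{\delta_2})=(1+W_{\delta_2})(1+W_{\delta_1})$; - (R-2) $(1+W_\delta)(1+V_\alpha)=(1+V_\alpha)^{M}(1+W_\delta)$, $M=(1+p)^{\langle\alpha,\delta^\vee\rangle}$; - (R-3) $(1+W_\delta)(1+U_\beta)=(1+U_\beta)^{M}(1+W_\delta)$, $M=(1+p)^{\langle\beta,\delta^\vee\rangle}$; - (R-4) $V_\alpha U_\beta=U_\beta V_\alpha$ if $\alpha+\beta\ne0$ and $\alpha+\beta\notin\Phi$; - (R-5) $(1+V_{\alpha_1})(1+V_{\alpha_2})=\prod(1+V_{i\alpha_1+j\alpha_2})^{c_{ij}}\,(1+V_{\alpha_2})(1+V_{\alpha_1})$; - (R-6) $(1+U_{\beta_1})(1+U_{\beta_2})=\prod(1+U_{i\beta_1+j\beta_2})^{c_{ij}p^{i+j-1}}\,(1+U_{\beta_2})(1+U_{\beta_1})$; - (R-7) $(1+V_\alpha)(1+U_\beta)=\prod_{i\alpha+j\beta\in\Phi^-}(1+U_{i\alpha+j\beta})^{c_{ij}p^{j-1}}\prod_{i\alpha+j\beta\in\Phi^+}(1+V_{i\alpha+j\beta})^{c_{ij}p^{j}}\,(1+U_\beta)(1+V_\alpha)$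 if $\alpha+\beta\neq0$; - (R-8) $(1+V_\alpha)(1+U_{-\alpha})=(1+U_{-\alpha})^{Q}\prod_{\delta\in\Delta}(1+W_\delta)^{n_\delta}\,(1+V_\alpha)^{Q}$, $Q=(1+p)^{-1}$, for all $\alpha,\alpha_1,\alpha_2\in\Phi^+$, $\beta,\beta_1,\beta_2\in\Phi^-$, $\delta,\delta_1,\delta_2\in\Delta$, the products running over $i,j>0$ for which the indicated combination is a root. Let $\overline{\mathcal A}$ be the reduction of $\mathcal A$ modulo $p$, $\overline{\mathcal R}$ the image of $\mathcal R$ and $\overline{\mathcal B}=\overline{\mathcal A}/\overline{\mathcal R}$. Give the variables the degrees $\deg V_\alpha=\mathrm{ht}(\alpha)$, $\deg W_\delta=h$, $\deg U_\beta=h+\mathrm{ht}(\beta)$, and let $\mathrm{Fil}^m\overline{\mathcal B}$ be the image of the set of series in $\overline{\mathcal A}$ all of whose monomials have degree at least $m$. Then in $\overline{\mathcal B}$, for all roots as above, - (R-2') $W_\delta V_\alpha\equiv V_\alpha W_\delta \pmod{\mathrm{Fil}^{\mathrm{ht}(\alpha)+h+1}}$; - (R-3') $W_\delta U_\beta\equiv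 U_\beta W_\delta \pmod{\mathrm{Fil}^{2h+\mathrm{ht}(\beta)+1}}$; - (R-5') $V_{\alpha_1}V_{\alpha_2}\equiv\sum_{i,j>0,\ i\alpha_1+j\alpha_2\in\Phi}c_{ij}V_{i\alpha_1+j\alpha_2}+V_{\alpha_2}V_{\alpha_1}\pmod{\mathrm{Fil}^{\mathrm{ht}(\alpha_1)+\mathrm{ht}(\alpha_2)+1}}$; - (R-6') $U_{\beta_1}U_{\beta_2}\equiv U_{\beta_2}U_{\beta_1}\pmod{\mathrm{Fil}^{2h+\mathrm{ht}(\beta_1)+\mathrm{ht}(\beta_2)+1}}$; - (R-7') if $\alpha+\beta\ne0$: $V_\alpha U_\beta\equiv c_{11}U_{\alpha+\beta}+U_\beta V_\alpha\pmod{\mathrm{Fil}^{h+\mathrm{ht}(\alpha)+\mathrm{ht}(\beta)+1}}$, where the term $c_{11}U_{\alpha+\beta}$ is omitted if $\alpha+\beta\notin\Phi^-$; - (R-8') $V_\alpha U_{-\alpha}\equiv\sum_{\delta\in\Delta}n_\delta W_\delta+U_{-\alpha}V_\alpha\pmod{\mathrm{Fil}^{h+1}}$. -/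

import Mathlib

/-! ### Non-commutative formal power series -/

/-- Formal power series in the non-commuting variables `σ` over `R`: a series
`∑ a_w w`, over all words `w` in the variables, is the family `w ↦ a_w` of its coefficients. -/
def NCPowerSeries (σ R : Type*) := List σ → R

namespace NCPowerSeries

variable {σ R : Type*}

/-- The series with given coefficients. -/
def mk (a : List σ → R) : NCPowerSeries σ R := a

theorem mk_apply (a : List σ → R) (w : List σ) : mk a w = a w := rfl

theorem ext {f g : NCPowerSeries σ R} (h : ∀ w, f w = g w) : f = g := funext h

instance [AddCommGroup R] : AddCommGroup (NCPowerSeries σ R) :=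
  inferInstanceAs (AddCommGroup (List σ → R))

/-- The product topology (coefficientwise convergence). For finitely many variables over `ℤ_[p]`
this is the topology defined by the powers of the maximal ideal `(p, X₁, …, X_d)`. -/
instance [TopologicalSpace R] : TopologicalSpace (NCPowerSeries σ R) :=
  inferInstanceAs (TopologicalSpace (List σ → R))

theorem add_apply [AddCommGroup R] (f g : NCPowerSeries σ R) (w : List σ) :
    (f + g) w = f w + g w := rfl

theorem zero_apply [AddCommGroup R] (w : List σ) : (0 : NCPowerSeries σ R) w = 0 := rfl

section Ring

variable [Ring R]

instance : One (NCPowerSeries σ R) := ⟨mk fun w => if w.length = 0 then 1 else 0⟩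

/-- The coefficient of `f * g` at `w` is the sum of `f u * g v` over all factorizations `w = u v`. -/
instance : Mul (NCPowerSeries σ R) :=
  ⟨fun f g => mk fun w => ∑ k ∈ Finset.range (w.length + 1), f (w.take k) * g (w.drop k)⟩

theorem one_apply (w : List σ) :
    (1 : NCPowerSeries σ R) w = if w.length = 0 then 1 else 0 := rfl

theorem mul_apply (f g : NCPowerSeries σ R) (w : List σ) :
    (f * g) w = ∑ k ∈ Finset.range (w.length + 1), f (w.take k) * g (w.drop k) := rfl

theorem mul_nil (f g : NCPowerSeries σ R) : (f * g) [] = f [] * g [] := by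
  simp [mul_apply]

theorem mul_cons (f g : NCPowerSeries σ R) (x : σ) (w : List σ) :
    (f * g) (x :: w) =
      (mk (fun v => f (x :: v)) * g) w + f [] * g (x :: w) := by
  rw [mul_apply, List.length_cons, Finset.sum_range_succ']
  simp [mul_apply, mk_apply]

protected theorem add_mul (f g h : NCPowerSeries σ R) : (f + g) * h = f * h + g * h :=
  ext fun w => by simp [mul_apply, add_apply, add_mul, Finset.sum_add_distrib]

protected theorem mul_add (f g h : NCPowerSeries σ R) : f * (g + h) = f * g + f * h :=
  ext fun w => by simp [mul_apply, add_apply, mul_add, Finset.sum_add_distrib]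

protected theorem zero_mul (f : NCPowerSeries σ R) : 0 * f = 0 :=
  ext fun w => by simp [mul_apply, zero_apply]

protected theorem mul_zero (f : NCPowerSeries σ R) : f * 0 = 0 :=
  ext fun w => by simp [mul_apply, zero_apply]

theorem smul_mul_apply (a : R) (f g : NCPowerSeries σ R) (w : List σ) :
    (mk (fun v => a * f v) * g) w = a * (f * g) w := by
  simp [mul_apply, mk_apply, Finset.mul_sum, mul_assoc]

protected theorem mul_assoc (f g h : NCPowerSeries σ R) : f * g * h = f * (g * h) := by
  refine ext fun w => ?_
  induction w generalizing f with
  | nil => simp [mul_nil, mul_assoc]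
  | cons x w ih =>
    have e : mk (fun v => (f * g) (x :: v)) =
        mk (fun v => f (x :: v)) * g + mk (fun v => f [] * mk (fun u => g (x :: u)) v) :=
      ext fun v => by rw [mk_apply, mul_cons, add_apply]; rfl
    rw [mul_cons, e, NCPowerSeries.add_mul, add_apply, ih, smul_mul_apply, mul_cons f,
      mul_cons g, mul_nil, mul_add, mul_assoc, add_assoc]

protected theorem one_mul (f : NCPowerSeries σ R) : 1 * f = f := by
  refine ext fun w => ?_
  cases w with
  | nil => simp [mul_nil, one_apply]
  | cons x w =>
    have e : mk (fun v => (1 : NCPowerSeries σ R) (x :: v)) = 0 :=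
      ext fun v => by simp [mk_apply, one_apply, zero_apply]
    rw [mul_cons, e, NCPowerSeries.zero_mul]
    simp [one_apply, zero_apply]

protected theorem mul_one (f : NCPowerSeries σ R) : f * 1 = f := by
  refine ext fun w => ?_
  induction w generalizing f with
  | nil => simp [mul_nil, one_apply]
  | cons x w ih =>
    rw [mul_cons, ih]
    simp [mk_apply, one_apply]

instance : Ring (NCPowerSeries σ R) where
  sub_eq_add_neg := sub_eq_add_neg
  left_distrib := NCPowerSeries.mul_add
  right_distrib := NCPowerSeries.add_mul
  zero_mul := NCPowerSeries.zero_mul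
  mul_zero := NCPowerSeries.mul_zero
  mul_assoc := NCPowerSeries.mul_assoc
  one_mul := NCPowerSeries.one_mul
  mul_one := NCPowerSeries.mul_one
  neg_add_cancel := neg_add_cancel
  zsmul := zsmulRec

/-- The variable `s` as a power series. -/
noncomputable def X (s : σ) : NCPowerSeries σ R :=
  open Classical in mk fun w => if w = [s] then 1 else 0

/-- The binomial series `(1 + X_s) ^ a = ∑ m, (a choose m) X_s ^ m`, for `a` in `R`. -/
noncomputable def onePlusPow {R : Type*} [CommRing R] [BinomialRing R] (s : σ) (a : R) :
    NCPowerSeries σ R :=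
  open Classical in mk fun w =>
    if w = List.replicate w.length s then Ring.choose a w.length else 0

/-- Application of a ring homomorphism to all coefficients. -/
def map {S : Type*} [Ring S] (φ : R →+* S) : NCPowerSeries σ R →+* NCPowerSeries σ S where
  toFun f := mk fun w => φ (f w)
  map_one' := ext fun w => by simp [mk_apply, one_apply, apply_ite φ]
  map_zero' := ext fun w => by simp [mk_apply, zero_apply]
  map_mul' f g := ext fun w => by simp [mk_apply, mul_apply]
  map_add' f g := ext fun w => by simp [mk_apply, add_apply]

/-- The weighted degree filtration: series all of whose monomials have degree at least `n`,
where the variable `s` has degree `deg s`. -/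
def degFil (deg : σ → ℤ) (n : ℤ) : AddSubgroup (NCPowerSeries σ R) where
  carrier := {f | ∀ w : List σ, f w ≠ 0 → n ≤ (w.map deg).sum}
  zero_mem' w h := absurd rfl h
  add_mem' {f g} hf hg w h := by
    by_cases h0 : f w = 0
    · exact hg w fun h1 => h (by rw [add_apply, h0, h1, add_zero])
    · exact hf w h0
  neg_mem' {f} hf w h := hf w fun h0 => h (by
    have : (-f) w + f w = 0 := by rw [← add_apply, neg_add_cancel, zero_apply]
    rwa [h0, add_zero] at this)

end Ring

end NCPowerSeries

/-- The smallest closed two-sided ideal containing a set. -/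
def closedTwoSidedSpan {A : Type*} [Ring A] [TopologicalSpace A] (S : Set A) : TwoSidedIdeal A :=
  sInf {I | IsClosed (I : Set A) ∧ S ⊆ (I : Set A)}

/-! ### The relations of the pro-`p` Iwahori -/

namespace Iwahori

open NCPowerSeries

variable {ι X₁ X₂ : Type*} [AddCommGroup X₁] [AddCommGroup X₂]

/-- The variables, `|Φ| + |Δ|` in number: one for each root `γ` (called `V_γ` when `γ` is positive
and `U_γ` when `γ` is negative) and one, `W_δ`, for each simple root `δ`. -/
inductive Var {P : RootDatum ι X₁ X₂} (b : P.Base) : Type _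
  | root (γ : ι) : Var b
  | torus (δ : b.support) : Var b

/-- `h = 1 + ht θ`, with `ht θ` the largest height of a root. -/
noncomputable def coxeterNumber {P : RootDatum ι X₁ X₂} (b : P.Base) : ℤ :=
  1 + ⨆ i, b.height i

/-- `deg V_α = ht α` for `α > 0`, `deg U_β = h + ht β` for `β < 0`, and `deg W_δ = h`. -/
noncomputable def deg {P : RootDatum ι X₁ X₂} (b : P.Base) : Var b → ℤ
  | .root γ => open Classical in
      if b.IsPos γ then b.height γ else coxeterNumber b + b.height γ
  | .torus _ => coxeterNumber b

/-- A choice of the orders in which the finite products in the relations are taken: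
for roots `α, β` with `α + β ≠ 0`, an enumeration of all `(i, j, γ)` with `i, j > 0` and
`γ = i α + j β` a root, and an enumeration of the simple roots. -/
structure ProductOrder {P : RootDatum ι X₁ X₂} (b : P.Base) where
  terms : ι → ι → List (ℕ × ℕ × ι)
  nodup_terms : ∀ α β, (terms α β).Nodup
  mem_terms : ∀ α β, P.root α + P.root β ≠ 0 → ∀ i j γ, (i, j, γ) ∈ terms α β ↔
    0 < i ∧ 0 < j ∧ P.root γ = i • P.root α + j • P.root β
  simple : List b.support
  nodup_simple : simple.Nodup
  mem_simple : ∀ δ, δ ∈ simple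

section

variable (p : ℕ) [Fact p.Prime]

/-- The unit `1 + p` of `ℤ_[p]`. -/
noncomputable def onePlusP : ℤ_[p]ˣ :=
  IsUnit.unit (a := 1 + (p : ℤ_[p])) <| by
    by_contra h
    have h1 : 1 + (p : ℤ_[p]) ∈ IsLocalRing.maximalIdeal ℤ_[p] :=
      (IsLocalRing.mem_maximalIdeal _).2 h
    have h2 : (p : ℤ_[p]) ∈ IsLocalRing.maximalIdeal ℤ_[p] := by
      rw [PadicInt.maximalIdeal_eq_span_p]
      exact Ideal.mem_span_singleton_self _
    exact (Ideal.ne_top_iff_one _).1 (IsLocalRing.maximalIdeal.isMaximal ℤ_[p]).ne_top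
      (by simpa using sub_mem h1 h2)

variable {P : RootDatum ι X₁ X₂} {b : P.Base}

/-- The algebra `𝒜` of non-commutative power series over `ℤ_[p]` in the variables. -/
abbrev PadicAlg (b : P.Base) := NCPowerSeries (Var b) ℤ_[p]

/-- `1 + V_γ` (for `γ > 0`) or `1 + U_γ` (for `γ < 0`), raised to a `p`-adic power. -/
noncomputable abbrev rootPow (b : P.Base) (γ : ι) (a : ℤ_[p]) : PadicAlg p b :=
  onePlusPow (Var.root γ) a

/-- `1 + W_δ`, raised to a `p`-adic power. -/
noncomputable abbrev torusPow (b : P.Base) (δ : b.support) (a : ℤ_[p]) : PadicAlg p b :=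
  onePlusPow (Var.torus δ) a

/-- The relations (R-1) to (R-8), in this order, each as the difference of its two sides.
Here `c α β i j` are the exponents in the commutator formula
`x_α(t) x_β(u) = ∏ x_{iα+jβ}(c_{ij} t^i u^j) x_β(u) x_α(t)` and `n α δ` the exponents in
`h_α(t) = ∏ h_δ(t)^{n_δ}`. The set is defined for any integers `c` and any natural numbers `n`. -/
inductive IsRelation (o : ProductOrder b) (c : ι → ι → ℕ → ℕ → ℤ) (n : ι → b.support → ℕ) :
    PadicAlg p b → Prop
  | r1 (δ₁ δ₂ : b.support) : IsRelation o c n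
      ((1 + X (.torus δ₁)) * (1 + X (.torus δ₂)) - (1 + X (.torus δ₂)) * (1 + X (.torus δ₁)))
  | r2 (δ : b.support) (α : ι) (hα : b.IsPos α) : IsRelation o c n
      ((1 + X (.torus δ)) * (1 + X (.root α)) -
        rootPow p b α ↑(onePlusP p ^ P.pairing α δ) * (1 + X (.torus δ)))
  | r3 (δ : b.support) (β : ι) (hβ : ¬ b.IsPos β) : IsRelation o c n
      ((1 + X (.torus δ)) * (1 + X (.root β)) -
        rootPow p b β ↑(onePlusP p ^ P.pairing β δ) * (1 + X (.torus δ)))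
  | r4 (α β : ι) (hα : b.IsPos α) (hβ : ¬ b.IsPos β) (h0 : P.root α + P.root β ≠ 0)
      (h : P.root α + P.root β ∉ Set.range P.root) : IsRelation o c n
      (X (.root α) * X (.root β) - X (.root β) * X (.root α))
  | r5 (α₁ α₂ : ι) (h₁ : b.IsPos α₁) (h₂ : b.IsPos α₂) : IsRelation o c n
      ((1 + X (.root α₁)) * (1 + X (.root α₂)) -
        ((o.terms α₁ α₂).map fun t => rootPow p b t.2.2 (c α₁ α₂ t.1 t.2.1 : ℤ_[p])).prod *
          (1 + X (.root α₂)) * (1 + X (.root α₁)))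
  | r6 (β₁ β₂ : ι) (h₁ : ¬ b.IsPos β₁) (h₂ : ¬ b.IsPos β₂) : IsRelation o c n
      ((1 + X (.root β₁)) * (1 + X (.root β₂)) -
        ((o.terms β₁ β₂).map fun t => rootPow p b t.2.2
          ((c β₁ β₂ t.1 t.2.1 : ℤ_[p]) * (p : ℤ_[p]) ^ (t.1 + t.2.1 - 1))).prod *
          (1 + X (.root β₂)) * (1 + X (.root β₁)))
  | r7 (α β : ι) (hα : b.IsPos α) (hβ : ¬ b.IsPos β) (h0 : P.root α + P.root β ≠ 0) :
      IsRelation o c n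
      ((1 + X (.root α)) * (1 + X (.root β)) -
        (open Classical in ((o.terms α β).filter fun t => ¬ b.IsPos t.2.2).map fun t =>
          rootPow p b t.2.2 ((c α β t.1 t.2.1 : ℤ_[p]) * (p : ℤ_[p]) ^ (t.2.1 - 1))).prod *
        (open Classical in ((o.terms α β).filter fun t => b.IsPos t.2.2).map fun t =>
          rootPow p b t.2.2 ((c α β t.1 t.2.1 : ℤ_[p]) * (p : ℤ_[p]) ^ t.2.1)).prod *
          (1 + X (.root β)) * (1 + X (.root α)))
  | r8 (α β : ι) (hα : b.IsPos α) (hβ : P.root β = -P.root α) : IsRelation o c n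
      ((1 + X (.root α)) * (1 + X (.root β)) -
        rootPow p b β ↑(onePlusP p)⁻¹ *
        (o.simple.map fun δ => torusPow p b δ (n α δ : ℤ_[p])).prod *
        rootPow p b α ↑(onePlusP p)⁻¹)

/-- The closed two-sided ideal `ℛ` of `𝒜` generated by the relations. -/
noncomputable def relIdeal (o : ProductOrder b) (c : ι → ι → ℕ → ℕ → ℤ)
    (n : ι → b.support → ℕ) : TwoSidedIdeal (PadicAlg p b) :=
  closedTwoSidedSpan {r | IsRelation p o c n r}

/-- The reduction of `𝒜` modulo `p`. -/
abbrev ModAlg (b : P.Base) := NCPowerSeries (Var b) (ZMod p)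

/-- The image of `ℛ` in the reduction of `𝒜` modulo `p`
(the reduction map is surjective, so that the image is an ideal). -/
noncomputable def relIdealBar (o : ProductOrder b) (c : ι → ι → ℕ → ℕ → ℤ)
    (n : ι → b.support → ℕ) : TwoSidedIdeal (ModAlg p b) :=
  (relIdeal p o c n).map (NCPowerSeries.map (PadicInt.toZMod (p := p)))

/-- The quotient of the reduction of `𝒜` modulo `p` by the image of `ℛ`. -/
abbrev Bbar (o : ProductOrder b) (c : ι → ι → ℕ → ℕ → ℤ) (n : ι → b.support → ℕ) :=
  (relIdealBar p o c n).ringCon.Quotient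

variable (o : ProductOrder b) (c : ι → ι → ℕ → ℕ → ℤ) (n : ι → b.support → ℕ)

/-- The image of the variable `V_γ` (for `γ > 0`) or `U_γ` (for `γ < 0`) in the quotient. -/
noncomputable def rootVar (γ : ι) : Bbar p o c n :=
  (relIdealBar p o c n).ringCon.mk' (X (.root γ))

/-- The image of the variable `W_δ` in the quotient. -/
noncomputable def torusVar (δ : b.support) : Bbar p o c n :=
  (relIdealBar p o c n).ringCon.mk' (X (.torus δ))

/-- The filtration `Fil^m` of the quotient induced by the degree filtration. -/
noncomputable def Fil (m : ℤ) : AddSubgroup (Bbar p o c n) :=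
  (degFil (deg b) m).map (relIdealBar p o c n).ringCon.mk'.toAddMonoidHom

end

end Iwahori

/-! The reduction mod p of each defining relation vanishes in the quotient. Hence an element whose
lift differs from a reduced relation by a series of degree at least m lies in `Fil m`
(`toBbar_mem_Fil`). Every congruence thereby becomes a degree estimate in the free power series ring
over `ZMod p`.

The estimates rest on binomial coefficients modulo p. If p^k divides a, then (a choose m) is 0 mod p
for 0 < m < p^k, so (1 + X)^a - 1 has degree at least p^k deg X (`map_onePlusPow_sub_one_mem`). If a
is 1 mod p, then (1 + X)^a agrees with 1 + X below degree p deg X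
(`map_onePlusPow_sub_one_add_X_mem`). An integer exponent c gives 1 + cX up to degree 2 deg X.

All variables have degree at least 1 and height is additive on roots, so p ≥ h + 2 pushes almost
every factor of the products beyond the required degree. The surviving linear terms are summed by
`list_prod_sub_one_sub_sum_mem`, and `commutator_mem_degFil` converts (1 + A)(1 + B) = Q(1 + B)(1 +
A) into a statement about AB - BA. -/

namespace NCPowerSeries

/-! ### The weighted degree filtration and products close to 1. -/

section degFil

variable {σ R : Type*} [Ring R] {deg : σ → ℤ}

theorem degFil_anti {m n : ℤ} (h : m ≤ n) :
    degFil (R := R) deg n ≤ degFil deg m :=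
  fun _ hf w hw => h.trans (hf w hw)

theorem one_mem_degFil : (1 : NCPowerSeries σ R) ∈ degFil deg 0 := by
  intro w hw
  rw [one_apply] at hw
  have : w = [] := by
    by_contra h
    simp [h] at hw
  simp [this]

theorem X_mem_degFil (s : σ) : (X s : NCPowerSeries σ R) ∈ degFil deg (deg s) := by
  intro w hw
  have : w = [s] := by
    by_contra h
    simp [X, mk_apply, h] at hw
  simp [this]

theorem mul_mem_degFil {f g : NCPowerSeries σ R} {k m n : ℤ} (hf : f ∈ degFil deg m)
    (hg : g ∈ degFil deg n) (hk : k ≤ m + n) : f * g ∈ degFil deg k := by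
  intro w hw
  rw [mul_apply] at hw
  obtain ⟨i, -, hi⟩ := Finset.exists_ne_zero_of_sum_ne_zero hw
  have h1 := hf _ (left_ne_zero_of_mul hi)
  have h2 := hg _ (right_ne_zero_of_mul hi)
  have h3 : (w.map deg).sum = ((w.take i).map deg).sum + ((w.drop i).map deg).sum := by
    rw [← List.sum_append, ← List.map_append, List.take_append_drop]
  omega

/-- The coefficient at a word, as an additive map. -/
def coeffHom (w : List σ) : NCPowerSeries σ R →+ R where
  toFun f := f w
  map_zero' := rfl
  map_add' _ _ := rfl

theorem zsmul_apply (c : ℤ) (f : NCPowerSeries σ R) (w : List σ) : (c • f) w = c • f w :=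
  map_zsmul (coeffHom w) c f

theorem sub_apply (f g : NCPowerSeries σ R) (w : List σ) : (f - g) w = f w - g w :=
  map_sub (coeffHom w) f g

/-- A product of factors `1 + y + (higher terms)` is `1 + ∑ y + (higher terms)`. -/
theorem list_prod_sub_one_sub_sum_mem {τ : Type*} (l : List τ) (f y : τ → NCPowerSeries σ R)
    {T : ℤ} (hT : 2 ≤ T) (hy : ∀ t ∈ l, y t ∈ degFil deg (T - 1))
    (hf : ∀ t ∈ l, f t - (1 + y t) ∈ degFil deg T) :
    (l.map y).sum ∈ degFil deg (T - 1) ∧ (l.map f).prod - (1 + (l.map y).sum) ∈ degFil deg T := by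
  induction l with
  | nil => simp [zero_mem]
  | cons t l ih =>
    obtain ⟨h1, h2⟩ := ih (fun t ht => hy t (by simp [ht])) (fun t ht => hf t (by simp [ht]))
    have hyt := hy t (by simp)
    have hft := hf t (by simp)
    simp only [List.map_cons, List.sum_cons, List.prod_cons]
    set S := (l.map y).sum
    set Q := (l.map f).prod
    refine ⟨add_mem hyt h1, ?_⟩
    have e : f t * Q - (1 + (y t + S)) =
        (f t - (1 + y t)) * (1 + S) + (1 + y t) * (Q - (1 + S)) +
          (f t - (1 + y t)) * (Q - (1 + S)) + y t * S := by
      noncomm_ring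
    rw [e]
    have h0 : ∀ {z : NCPowerSeries σ R}, z ∈ degFil deg (T - 1) → 1 + z ∈ degFil deg 0 :=
      fun hz => add_mem one_mem_degFil (degFil_anti (by omega) hz)
    refine add_mem (add_mem (add_mem ?_ ?_) ?_) ?_
    · exact mul_mem_degFil hft (h0 h1) (by omega)
    · exact mul_mem_degFil (h0 hyt) h2 (by omega)
    · exact mul_mem_degFil hft h2 (by omega)
    -- Both factors have degree at least T - 1, and 2(T - 1) ≥ T because T ≥ 2.
    · exact mul_mem_degFil hyt h1 (by omega)

theorem list_prod_sub_one_mem {τ : Type*} (l : List τ) (f : τ → NCPowerSeries σ R)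
    {T : ℤ} (hT : 2 ≤ T) (hf : ∀ t ∈ l, f t - 1 ∈ degFil deg T) :
    (l.map f).prod - 1 ∈ degFil deg T := by
  have := (list_prod_sub_one_sub_sum_mem l f (fun _ => 0) hT (fun _ _ => zero_mem _)
    (by simpa using hf)).2
  simpa using this

/-- From `(1 + A) (1 + B) = Q (1 + B) (1 + A)` with `Q = 1 + S + ⋯` one gets
`A B = S + B A + ⋯`. -/
theorem commutator_mem_degFil {A B S Q : NCPowerSeries σ R} {T : ℤ}
    (hA : A ∈ degFil deg 1) (hB : B ∈ degFil deg 1) (hS : S ∈ degFil deg (T - 1))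
    (hQ : Q - (1 + S) ∈ degFil deg T) :
    A * B - (S + B * A) - ((1 + A) * (1 + B) - Q * (1 + B) * (1 + A)) ∈ degFil deg T := by
  have e : A * B - (S + B * A) - ((1 + A) * (1 + B) - Q * (1 + B) * (1 + A)) =
      (Q - (1 + S)) * ((1 + B) * (1 + A)) + S * (B + (1 + B) * A) := by
    noncomm_ring
  have h1 : (1 : NCPowerSeries σ R) ∈ degFil deg 0 := one_mem_degFil
  have hB' : 1 + B ∈ degFil deg 0 := add_mem h1 (degFil_anti (by omega) hB)
  have hA' : 1 + A ∈ degFil deg 0 := add_mem h1 (degFil_anti (by omega) hA)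
  rw [e]
  refine add_mem (mul_mem_degFil hQ (mul_mem_degFil hB' hA' le_rfl) (by omega))
    (mul_mem_degFil hS (add_mem hB (mul_mem_degFil hB' hA le_rfl)) (by omega))

end degFil

/-! ### Binomial series with p-adic exponents, reduced mod p. -/

section padic

variable {σ : Type*} {p : ℕ} [Fact p.Prime] {deg : σ → ℤ}

theorem map_X {R S : Type*} [Ring R] [Ring S] (φ : R →+* S) (s : σ) :
    map φ (X s) = X s :=
  ext fun w => by
    change φ (X s w) = X s w
    simp only [X, mk_apply]
    split_ifs <;> simp

/-- In m (N choose m) = N (N - 1 choose m - 1) the right side is divisible by p^k. Were (N choose m)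
a unit, p^k would divide m, which is too small. -/
theorem toZMod_choose_eq_zero {N : ℤ_[p]} {k m : ℕ} (hN : (p : ℤ_[p]) ^ k ∣ N) (hm : 0 < m)
    (hmk : m < p ^ k) : PadicInt.toZMod (Ring.choose N m) = 0 := by
  obtain ⟨m, rfl⟩ := Nat.exists_eq_succ_of_ne_zero hm.ne'
  have h1 := Ring.choose_smul_choose N (n := m + 1) (k := 1) (by omega)
  rw [Nat.choose_one_right, Ring.choose_one_right, nsmul_eq_mul] at h1
  rw [← RingHom.mem_ker, PadicInt.ker_toZMod]
  by_contra hc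
  have hu : IsUnit (Ring.choose N (m + 1)) := by
    by_contra h
    exact hc ((IsLocalRing.mem_maximalIdeal _).2 h)
  have h2 : (p : ℤ_[p]) ^ k ∣ ((m + 1 : ℕ) : ℤ_[p]) := by
    rw [← hu.dvd_mul_right, h1]
    exact hN.mul_right _
  have h3 : p ^ k ∣ m + 1 := by
    have := (PadicInt.norm_int_le_pow_iff_dvd (p := p) (k := ((m + 1 : ℕ) : ℤ)) (n := k)).1 (by
      rw [PadicInt.norm_le_pow_iff_mem_span_pow, Ideal.mem_span_singleton]
      exact_mod_cast h2)
    exact_mod_cast this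
  exact absurd (Nat.le_of_dvd (by omega) h3) (by omega)

theorem map_onePlusPow_sub_mem (s : σ) (a : ℤ_[p]) (c : ℤ) {T : ℤ}
    (h1 : PadicInt.toZMod a = (c : ZMod p))
    (h2 : ∀ m : ℕ, 2 ≤ m → PadicInt.toZMod (Ring.choose a m) ≠ 0 → T ≤ m * deg s) :
    map PadicInt.toZMod (onePlusPow s a) - (1 + c • X s) ∈ degFil deg T := by
  intro w hw
  rw [sub_apply, add_apply, zsmul_apply, one_apply] at hw
  change PadicInt.toZMod (onePlusPow s a w) - _ ≠ 0 at hw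
  simp only [onePlusPow, X, mk_apply] at hw
  match w, hw with
  | [], hw => simp [-smul_ite] at hw
  | [t], hw =>
    refine absurd ?_ hw
    by_cases h : t = s <;> simp [h, h1, -smul_ite]
  | t :: u :: v, hw =>
    have hr : t :: u :: v = List.replicate (t :: u :: v).length s := by
      by_contra h
      rw [if_neg h] at hw
      simp at hw
    rw [if_pos hr] at hw
    have := h2 (t :: u :: v).length (by simp) (by simpa using hw)
    rw [hr, List.map_replicate, List.sum_replicate]
    simpa using this

/-- The case k = 0 is allowed and useful: it says that a factor whose variable already has degree at
least T is 1, whatever its exponent. -/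
theorem map_onePlusPow_sub_one_mem (s : σ) {a : ℤ_[p]} {k : ℕ} (ha : (p : ℤ_[p]) ^ k ∣ a)
    {T : ℤ} (hs : 0 ≤ deg s) (hT : T ≤ p ^ k * deg s) :
    map PadicInt.toZMod (onePlusPow s a) - 1 ∈ degFil deg T := by
  obtain ⟨c, hc⟩ : ∃ c : ℤ, PadicInt.toZMod a = (c : ZMod p) :=
    ⟨(PadicInt.toZMod a).cast, by simp⟩
  have key : ∀ m : ℕ, 1 ≤ m → PadicInt.toZMod (Ring.choose a m) ≠ 0 → T ≤ m * deg s := by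
    intro m hm h
    refine hT.trans (mul_le_mul_of_nonneg_right ?_ hs)
    by_contra! hlt
    exact h (toZMod_choose_eq_zero ha hm (by exact_mod_cast hlt))
  have h := map_onePlusPow_sub_mem s a c hc fun m hm => key m (by omega)
  have hX : c • (X s : NCPowerSeries σ (ZMod p)) ∈ degFil deg T := by
    -- The linear term, too, must have degree at least T: either its coefficient vanishes, or `key`
    -- with m = 1 gives T ≤ deg s.
    by_cases h0 : PadicInt.toZMod a = 0
    · intro w hw
      rw [zsmul_apply, zsmul_eq_mul, ← hc, h0, zero_mul] at hw
      exact absurd rfl hw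
    · refine zsmul_mem (degFil_anti ?_ (X_mem_degFil s)) c
      simpa using key 1 le_rfl (by simpa using h0)
  have := add_mem h hX
  rwa [← sub_sub, sub_add_cancel] at this

theorem map_onePlusPow_intCast_sub_mem (s : σ) (c : ℤ) {T : ℤ} (hs : 0 ≤ deg s)
    (hT : T ≤ 2 * deg s) :
    map PadicInt.toZMod (onePlusPow s (c : ℤ_[p])) - (1 + c • X s) ∈ degFil deg T :=
  map_onePlusPow_sub_mem s _ c (by simp) fun m hm _ =>
    hT.trans (mul_le_mul_of_nonneg_right (by exact_mod_cast hm) hs)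

theorem map_onePlusPow_sub_one_add_X_mem (s : σ) {a : ℤ_[p]} (ha : PadicInt.toZMod a = 1)
    {T : ℤ} (hs : 0 ≤ deg s) (hT : T ≤ p * deg s) :
    map PadicInt.toZMod (onePlusPow s a) - (1 + X s) ∈ degFil deg T := by
  have h := map_onePlusPow_sub_mem (deg := deg) (T := T) s a 1 (by simpa using ha) (by
    intro m hm h
    refine hT.trans (mul_le_mul_of_nonneg_right ?_ hs)
    by_contra! hlt
    refine h ?_
    obtain ⟨k, rfl⟩ := Nat.exists_eq_add_of_le' (show 1 ≤ m by omega)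
    have hd : (p : ℤ_[p]) ^ 1 ∣ a - 1 := by
      rw [pow_one, ← Ideal.mem_span_singleton, ← PadicInt.maximalIdeal_eq_span_p,
        ← PadicInt.ker_toZMod, RingHom.mem_ker, map_sub, ha, map_one, sub_self]
    have hlt' : k + 1 < p := by exact_mod_cast hlt
    -- Pascal's rule reduces to a - 1, which p divides; both coefficients vanish since their lower
    -- indices lie strictly between 0 and p.
    have e := Ring.choose_succ_succ (a - 1) k
    rw [sub_add_cancel] at e
    rw [e, map_add, toZMod_choose_eq_zero hd (by omega) (by rw [pow_one]; omega),
      toZMod_choose_eq_zero hd (by omega) (by rw [pow_one]; omega), add_zero])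
  simpa using h

end padic

end NCPowerSeries

/-! ### Additivity of the height. -/

namespace RootPairing.Base

variable {ι X₁ X₂ : Type*} [AddCommGroup X₁] [AddCommGroup X₂] {P : RootDatum ι X₁ X₂}

theorem height_nsmul_add_nsmul (b : P.Base) {α β γ : ι} {i j : ℕ}
    (h : P.root γ = i • P.root α + j • P.root β) :
    b.height γ = i * b.height α + j * b.height β := by
  obtain ⟨f, -, -, hf⟩ := b.exists_root_eq_sum_int α
  obtain ⟨g, -, -, hg⟩ := b.exists_root_eq_sum_int β
  have hfg : P.root γ =
      ∑ l ∈ b.support, ((i : ℤ) • f + (j : ℤ) • g) l • P.root l := by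
    simp_rw [Pi.add_apply, Pi.smul_apply, add_smul, smul_assoc, Finset.sum_add_distrib,
      ← Finset.smul_sum, ← hf, ← hg, natCast_zsmul]
    exact h
  simp_rw [height_eq_sum hf, height_eq_sum hg, height_eq_sum hfg, Pi.add_apply, Pi.smul_apply,
    Finset.sum_add_distrib, Finset.mul_sum, smul_eq_mul]

theorem height_eq_neg (b : P.Base) {α β : ι} (h : P.root β = -P.root α) :
    b.height β = -b.height α := by
  rw [← b.height_reflectionPerm_self]
  congr 1
  exact P.root.injective (by simpa using h)

end RootPairing.Base

/-! ### Degrees of the variables and projection to the quotient. -/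

namespace Iwahori

open NCPowerSeries

variable {ι X₁ X₂ : Type*} [AddCommGroup X₁] [AddCommGroup X₂] {P : RootDatum ι X₁ X₂}
  {b : P.Base}

theorem height_lt_coxeterNumber [Finite ι] (b : P.Base) (γ : ι) :
    b.height γ < coxeterNumber b := by
  have : b.height γ ≤ ⨆ i, b.height i := le_ciSup (Set.finite_range b.height).bddAbove γ
  rw [coxeterNumber]
  linarith

/-- The negative of a root is a root, so the upper bound on heights is also a lower bound. This is
what makes the degrees of the U variables positive. -/
theorem neg_coxeterNumber_lt_height [Finite ι] (b : P.Base) (γ : ι) :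
    -coxeterNumber b < b.height γ := by
  have h := height_lt_coxeterNumber b (P.reflectionPerm γ γ)
  rw [b.height_eq_neg (α := γ) (by simp)] at h
  omega

theorem deg_pos_root {γ : ι} (h : b.IsPos γ) : deg b (.root γ) = b.height γ := by
  simp [deg, h]

theorem deg_neg_root {γ : ι} (h : ¬ b.IsPos γ) :
    deg b (.root γ) = coxeterNumber b + b.height γ := by
  simp [deg, h]

theorem deg_torus (δ : b.support) : deg b (.torus δ) = coxeterNumber b := rfl

theorem one_le_deg_root [Finite ι] (γ : ι) : 1 ≤ deg b (.root γ) := by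
  by_cases h : b.IsPos γ
  · rw [deg_pos_root h]
    exact h
  · rw [deg_neg_root h]
    have := neg_coxeterNumber_lt_height b γ
    omega

variable {p : ℕ} [Fact p.Prime] {o : ProductOrder b} {c : ι → ι → ℕ → ℕ → ℤ}
  {n : ι → b.support → ℕ}

theorem toZMod_onePlusP_zpow (k : ℤ) :
    PadicInt.toZMod (↑(onePlusP p ^ k) : ℤ_[p]) = 1 := by
  have h : Units.map (PadicInt.toZMod (p := p)).toMonoidHom (onePlusP p) = 1 := by
    ext
    simp [onePlusP]
  have h' := congrArg Units.val
    (map_zpow (Units.map (PadicInt.toZMod (p := p)).toMonoidHom) (onePlusP p) k)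
  rw [h, one_zpow] at h'
  exact h'

theorem toZMod_onePlusP_inv : PadicInt.toZMod (↑(onePlusP p)⁻¹ : ℤ_[p]) = 1 := by
  simpa using toZMod_onePlusP_zpow (p := p) (-1)

variable (p o c n) in
/-- The projection onto the quotient. -/
noncomputable def toBbar (x : ModAlg p b) : Bbar p o c n :=
  (relIdealBar p o c n).ringCon.mk' x

theorem toBbar_root (γ : ι) : toBbar p o c n (X (.root γ)) = rootVar p o c n γ := rfl

theorem toBbar_torus (δ : b.support) : toBbar p o c n (X (.torus δ)) = torusVar p o c n δ := rfl

theorem toBbar_add (x y : ModAlg p b) :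
    toBbar p o c n (x + y) = toBbar p o c n x + toBbar p o c n y := rfl

theorem toBbar_sub (x y : ModAlg p b) :
    toBbar p o c n (x - y) = toBbar p o c n x - toBbar p o c n y := rfl

theorem toBbar_mul (x y : ModAlg p b) :
    toBbar p o c n (x * y) = toBbar p o c n x * toBbar p o c n y := rfl

theorem toBbar_zsmul (k : ℤ) (x : ModAlg p b) :
    toBbar p o c n (k • x) = k • toBbar p o c n x := rfl

theorem toBbar_nsmul (k : ℕ) (x : ModAlg p b) :
    toBbar p o c n (k • x) = k • toBbar p o c n x := rfl

theorem toBbar_list_sum {τ : Type*} (l : List τ) (f : τ → ModAlg p b) :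
    toBbar p o c n (l.map f).sum = (l.map fun t => toBbar p o c n (f t)).sum := by
  induction l with
  | nil => rfl
  | cons t l ih => rw [List.map_cons, List.sum_cons, toBbar_add, ih, List.map_cons, List.sum_cons]

theorem toBbar_mem_Fil {r : PadicAlg p b} (hr : IsRelation p o c n r) {x : ModAlg p b} {m : ℤ}
    (hx : x - map PadicInt.toZMod r ∈ degFil (deg b) m) :
    toBbar p o c n x ∈ Fil p o c n m := by
  refine ⟨_, hx, ?_⟩
  have h1 : r ∈ relIdeal p o c n := by
    rw [relIdeal, closedTwoSidedSpan, TwoSidedIdeal.mem_sInf]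
    exact fun I hI => hI.2 hr
  have h2 : map PadicInt.toZMod r ∈ relIdealBar p o c n :=
    TwoSidedIdeal.subset_span ⟨r, h1, rfl⟩
  have h3 : (relIdealBar p o c n).ringCon.mk' (map PadicInt.toZMod r) = 0 :=
    (RingCon.eq _).2 h2
  change (relIdealBar p o c n).ringCon.mk' (x - map PadicInt.toZMod r) = _
  rw [map_sub, h3, sub_zero]
  rfl

/-! ### The congruences, one type of relation at a time. -/

variable [Finite ι]

theorem coxeterNumber_pos (γ : ι) : 0 < coxeterNumber b := by
  have := height_lt_coxeterNumber b γ
  have := neg_coxeterNumber_lt_height b γ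
  omega

theorem X_root_mem (γ : ι) : (X (.root γ) : ModAlg p b) ∈ degFil (deg b) 1 :=
  degFil_anti (one_le_deg_root γ) (X_mem_degFil _)

/-- A relation `(1 + W) (1 + X) = (1 + X) ^ M (1 + W)` with `M ≡ 1` modulo `p`. -/
theorem torus_commutator_mem (hp : coxeterNumber b + 1 < p) (δ : b.support) (γ : ι) (k : ℤ)
    (h : IsRelation p o c n ((1 + X (.torus δ)) * (1 + X (.root γ)) -
        rootPow p b γ ↑(onePlusP p ^ k) * (1 + X (.torus δ)))) :
    torusVar p o c n δ * rootVar p o c n γ - rootVar p o c n γ * torusVar p o c n δ ∈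
      Fil p o c n (coxeterNumber b + deg b (.root γ) + 1) := by
  rw [← toBbar_root, ← toBbar_torus, ← toBbar_mul, ← toBbar_mul, ← toBbar_sub]
  refine toBbar_mem_Fil h ?_
  simp only [map_sub, map_mul, map_add, map_one, map_X]
  have h1 := one_le_deg_root (b := b) γ
  have h2 := coxeterNumber_pos (b := b) γ
  -- With d the degree of the root variable, the bound is p d ≥ h + d + 1; the case d = 1 needs
  -- exactly p ≥ h + 2.
  have hM := map_onePlusPow_sub_one_add_X_mem (deg := deg b) (p := p) (.root γ)
    (T := coxeterNumber b + deg b (.root γ) + 1) (toZMod_onePlusP_zpow k) (by omega) (by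
      nlinarith [mul_nonneg h2.le (sub_nonneg.2 h1)])
  have hW : (1 + X (.torus δ) : ModAlg p b) ∈ degFil (deg b) 0 :=
    add_mem one_mem_degFil (degFil_anti (by rw [deg_torus]; omega) (X_mem_degFil _))
  have := mul_mem_degFil hM hW (add_zero _).ge
  convert this using 1
  noncomm_ring

/-- The exponents carry no power of p, so each factor contributes its linear term. Terms with (i, j)
≠ (1, 1) have higher degree and may be kept harmlessly. -/
theorem pos_mul_pos_congr (α₁ α₂ : ι) (h₁ : b.IsPos α₁) (h₂ : b.IsPos α₂) :
    rootVar p o c n α₁ * rootVar p o c n α₂ -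
      (((o.terms α₁ α₂).map fun t => c α₁ α₂ t.1 t.2.1 • rootVar p o c n t.2.2).sum +
        rootVar p o c n α₂ * rootVar p o c n α₁)
      ∈ Fil p o c n (b.height α₁ + b.height α₂ + 1) := by
  have h := toBbar_mem_Fil (IsRelation.r5 (o := o) (c := c) (n := n) (p := p) α₁ α₂ h₁ h₂)
    (x := X (.root α₁) * X (.root α₂) - (((o.terms α₁ α₂).map fun t =>
      c α₁ α₂ t.1 t.2.1 • X (.root t.2.2)).sum + X (.root α₂) * X (.root α₁)))
    (m := b.height α₁ + b.height α₂ + 1) ?_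
  · simpa only [toBbar_sub, toBbar_add, toBbar_mul, toBbar_list_sum, toBbar_zsmul,
      toBbar_root] using h
  simp only [map_sub, map_mul, map_add, map_one, map_X, map_list_prod, List.map_map]
  have p1 : 0 < b.height α₁ := h₁
  have p2 : 0 < b.height α₂ := h₂
  -- `o.mem_terms` controls the list only for roots that are not opposite; here both heights are
  -- positive.
  have h0 : P.root α₁ + P.root α₂ ≠ 0 := fun h => by
    have := b.height_eq_neg (α := α₁) (β := α₂) (eq_neg_of_add_eq_zero_right h)
    omega
  have hd : ∀ t ∈ o.terms α₁ α₂, b.height α₁ + b.height α₂ ≤ deg b (.root t.2.2) := by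
    rintro ⟨i, j, γ⟩ ht
    obtain ⟨hi, hj, hγ⟩ := (o.mem_terms _ _ h0 i j γ).1 ht
    have e := b.height_nsmul_add_nsmul hγ
    have hi' : (1 : ℤ) ≤ i := by exact_mod_cast hi
    have hj' : (1 : ℤ) ≤ j := by exact_mod_cast hj
    have : b.height α₁ + b.height α₂ ≤ b.height γ := by nlinarith
    rwa [deg_pos_root (show b.IsPos γ from (by omega : 0 < b.height α₁ + b.height α₂).trans_le this)]
  have key := list_prod_sub_one_sub_sum_mem (deg := deg b) (o.terms α₁ α₂)
    (⇑(map (PadicInt.toZMod (p := p))) ∘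
      fun t => rootPow p b t.2.2 (c α₁ α₂ t.1 t.2.1 : ℤ_[p]))
    (fun t => c α₁ α₂ t.1 t.2.1 • X (.root t.2.2)) (T := b.height α₁ + b.height α₂ + 1)
    (by omega)
    (fun t ht => zsmul_mem (degFil_anti (by have := hd t ht; omega) (X_mem_degFil _)) _)
    (fun t ht => map_onePlusPow_intCast_sub_mem _ _ (by have := hd t ht; omega)
      (by have := hd t ht; omega))
  exact commutator_mem_degFil (X_root_mem _) (X_root_mem _) key.1 key.2

/-- Every exponent is divisible by p, as i + j - 1 ≥ 1, so the whole product is 1 up to the required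
degree. -/
theorem neg_mul_neg_congr (hp : coxeterNumber b + 1 < p) (β₁ β₂ : ι)
    (h₁ : ¬ b.IsPos β₁) (h₂ : ¬ b.IsPos β₂) :
    rootVar p o c n β₁ * rootVar p o c n β₂ - rootVar p o c n β₂ * rootVar p o c n β₁
      ∈ Fil p o c n (2 * coxeterNumber b + b.height β₁ + b.height β₂ + 1) := by
  rw [← toBbar_root, ← toBbar_root, ← toBbar_mul, ← toBbar_mul, ← toBbar_sub]
  refine toBbar_mem_Fil (IsRelation.r6 β₁ β₂ h₁ h₂) ?_
  simp only [map_sub, map_mul, map_add, map_one, map_X, map_list_prod, List.map_map]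
  have p1 : b.height β₁ < 0 := lt_of_le_of_ne (not_lt.1 h₁) (b.height_ne_zero _)
  have p2 : b.height β₂ < 0 := lt_of_le_of_ne (not_lt.1 h₂) (b.height_ne_zero _)
  have q1 := neg_coxeterNumber_lt_height b β₁
  have q2 := neg_coxeterNumber_lt_height b β₂
  have h0 : P.root β₁ + P.root β₂ ≠ 0 := fun h => by
    have := b.height_eq_neg (α := β₁) (β := β₂) (eq_neg_of_add_eq_zero_right h)
    omega
  have key := list_prod_sub_one_mem (deg := deg b) (o.terms β₁ β₂)
    (⇑(map (PadicInt.toZMod (p := p))) ∘ fun t => rootPow p b t.2.2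
      ((c β₁ β₂ t.1 t.2.1 : ℤ_[p]) * (p : ℤ_[p]) ^ (t.1 + t.2.1 - 1)))
    (T := 2 * coxeterNumber b + b.height β₁ + b.height β₂ + 1)
    (by omega) (by
      rintro ⟨i, j, γ⟩ ht
      obtain ⟨hi, hj, hγ⟩ := (o.mem_terms _ _ h0 i j γ).1 ht
      have hd := one_le_deg_root (b := b) γ
      refine map_onePlusPow_sub_one_mem (k := i + j - 1) _ (Dvd.intro_left _ rfl)
        (zero_le_one.trans hd) ?_
      -- For i = j = 1 the variable has degree d = h + ht β₁ + ht β₂, and p d ≥ h + d + 1. Otherwise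
      -- p^2 divides the exponent, and p^2 alone exceeds the bound, which is below 2h.
      by_cases hij : i = 1 ∧ j = 1
      · obtain ⟨rfl, rfl⟩ := hij
        have e := b.height_nsmul_add_nsmul hγ
        push_cast at e
        have hn : ¬ b.IsPos γ := not_lt.2 (by omega)
        rw [deg_neg_root hn] at hd ⊢
        rw [show 1 + 1 - 1 = 1 from rfl, pow_one]
        nlinarith
      · have h2 : (p : ℤ) ^ 2 ≤ (p : ℤ) ^ (i + j - 1) :=
          pow_le_pow_right₀ (by omega) (by omega)
        nlinarith)
  have := commutator_mem_degFil (A := (X (.root β₁) : ModAlg p b)) (B := X (.root β₂)) (S := 0)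
    (X_root_mem _) (X_root_mem _) (zero_mem _) (by simpa using key)
  rwa [zero_add] at this

/-- The common form of the relations for a positive and a negative root that are not opposite,
for a given linear part `y` of the factors of the product. -/
theorem pos_mul_neg_congr (hp : coxeterNumber b + 1 < p) (α β : ι) (hα : b.IsPos α) (hβ : ¬ b.IsPos β)
    (h0 : P.root α + P.root β ≠ 0) (y : ℕ × ℕ × ι → ModAlg p b)
    (hy : ∀ i j γ, (i, j, γ) ∈ o.terms α β → ¬ b.IsPos γ →
      y (i, j, γ) = if i = 1 ∧ j = 1 then c α β 1 1 • X (.root γ) else 0) :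
    toBbar p o c n (X (.root α) * X (.root β) -
      ((open Classical in ((o.terms α β).filter fun t => ¬ b.IsPos t.2.2).map y).sum +
        X (.root β) * X (.root α)))
      ∈ Fil p o c n (coxeterNumber b + b.height α + b.height β + 1) := by
  classical
  refine toBbar_mem_Fil (IsRelation.r7 α β hα hβ h0) ?_
  simp only [map_sub, map_mul, map_add, map_one, map_X, map_list_prod, List.map_map]
  have p1 : 0 < b.height α := hα
  have p2 : b.height β < 0 := lt_of_le_of_ne (not_lt.1 hβ) (b.height_ne_zero _)
  have q1 := height_lt_coxeterNumber b α
  have q2 := neg_coxeterNumber_lt_height b β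
  have hsq : ∀ {k : ℕ} {d : ℤ}, 2 ≤ k → 1 ≤ d →
      coxeterNumber b + b.height α + b.height β + 1 ≤ (p : ℤ) ^ k * d := by
    intro k d hk hd
    have h2 : (p : ℤ) ^ 2 ≤ (p : ℤ) ^ k := pow_le_pow_right₀ (by omega) hk
    nlinarith
  have key := list_prod_sub_one_sub_sum_mem (deg := deg b)
    ((o.terms α β).filter fun t => ¬ b.IsPos t.2.2)
    (⇑(map (PadicInt.toZMod (p := p))) ∘ fun t =>
      rootPow p b t.2.2 ((c α β t.1 t.2.1 : ℤ_[p]) * (p : ℤ_[p]) ^ (t.2.1 - 1)))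
    y (T := coxeterNumber b + b.height α + b.height β + 1)
    (by omega) (by
      rintro ⟨i, j, γ⟩ ht
      obtain ⟨ht, hn⟩ : _ ∧ ¬ b.IsPos γ := by simpa using ht
      obtain ⟨hi, hj, hγ⟩ := (o.mem_terms _ _ h0 i j γ).1 ht
      have e := b.height_nsmul_add_nsmul hγ
      rw [hy i j γ ht hn]
      split_ifs with hij
      · obtain ⟨rfl, rfl⟩ := hij
        push_cast at e
        exact zsmul_mem (degFil_anti (by rw [deg_neg_root hn]; omega) (X_mem_degFil _)) _
      · exact zero_mem _) (by
      rintro ⟨i, j, γ⟩ ht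
      obtain ⟨ht, hn⟩ : _ ∧ ¬ b.IsPos γ := by simpa using ht
      obtain ⟨hi, hj, hγ⟩ := (o.mem_terms _ _ h0 i j γ).1 ht
      have e := b.height_nsmul_add_nsmul hγ
      have hd := one_le_deg_root (b := b) γ
      rw [hy i j γ ht hn]
      split_ifs with hij
      · obtain ⟨rfl, rfl⟩ := hij
        push_cast at e
        have hdeg := deg_neg_root hn
        have := map_onePlusPow_intCast_sub_mem (deg := deg b) (p := p) (.root γ) (c α β 1 1)
          (T := coxeterNumber b + b.height α + b.height β + 1) (by omega) (by omega)
        simpa using this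
      · rw [add_zero]
        refine map_onePlusPow_sub_one_mem (k := j - 1) _ (Dvd.intro_left _ rfl)
          (zero_le_one.trans hd) ?_
        -- The exponent is divisible by p^(j-1). If j = 1, then i ≥ 2 and the extra multiple of ht α
        -- already raises the degree enough. If j = 2, one factor p suffices when ht α + ht β ≤ 1;
        -- otherwise the variable has degree at least 2, and 2p exceeds the bound. If j ≥ 3, p^2
        -- suffices.
        obtain rfl | rfl | hj3 : j = 1 ∨ j = 2 ∨ 3 ≤ j := by omega
        · have hi2 : (2 : ℤ) ≤ i := by
            have : 2 ≤ i := by omega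
            exact_mod_cast this
          rw [deg_neg_root hn]
          push_cast at e
          rw [e]
          simp only [Nat.sub_self, pow_zero, one_mul]
          nlinarith
        · rw [deg_neg_root hn] at hd ⊢
          push_cast at e
          have hi1 : (1 : ℤ) ≤ i := by exact_mod_cast hi
          rw [show 2 - 1 = 1 from rfl, pow_one]
          by_cases hab : b.height α + b.height β ≤ 1
          · nlinarith
          · have h2 : 2 ≤ coxeterNumber b + b.height γ := by nlinarith
            nlinarith
        · exact hsq (by omega) hd)
  have key2 := list_prod_sub_one_mem (deg := deg b)
    ((o.terms α β).filter fun t => b.IsPos t.2.2)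
    (⇑(map (PadicInt.toZMod (p := p))) ∘ fun t =>
      rootPow p b t.2.2 ((c α β t.1 t.2.1 : ℤ_[p]) * (p : ℤ_[p]) ^ t.2.1))
    (T := coxeterNumber b + b.height α + b.height β + 1)
    (by omega) (by
      rintro ⟨i, j, γ⟩ ht
      obtain ⟨ht, hn⟩ : _ ∧ b.IsPos γ := by simpa using ht
      obtain ⟨hi, hj, hγ⟩ := (o.mem_terms _ _ h0 i j γ).1 ht
      have e := b.height_nsmul_add_nsmul hγ
      have hd := one_le_deg_root (b := b) γ
      refine map_onePlusPow_sub_one_mem (k := j) _ (Dvd.intro_left _ rfl)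
        (zero_le_one.trans hd) ?_
      -- For j = 1, ht γ ≥ ht α + ht β, so p ht γ ≥ h + ht γ + 1 is enough.
      obtain rfl | hj2 : j = 1 ∨ 2 ≤ j := by omega
      · rw [deg_pos_root hn] at hd ⊢
        have hi1 : (1 : ℤ) ≤ i := by exact_mod_cast hi
        push_cast at e
        have : b.height α + b.height β ≤ b.height γ := by nlinarith
        rw [pow_one]
        nlinarith
      · exact hsq hj2 hd)
  refine commutator_mem_degFil (X_root_mem _) (X_root_mem _) key.1 ?_
  -- For the product N of the U factors and P of the V factors, NP - (1 + S) = (N - (1 + S)) + N(P -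
  -- 1).
  have hN := add_mem (degFil_anti (by omega) key.2)
    (add_mem one_mem_degFil (degFil_anti (by omega) key.1))
  rw [sub_add_cancel] at hN
  have := add_mem key.2 (mul_mem_degFil hN key2 (zero_add _).ge)
  convert this using 1
  noncomm_ring

theorem pos_mul_neg_congr_of_neg (hp : coxeterNumber b + 1 < p) (α β γ : ι) (hα : b.IsPos α)
    (hβ : ¬ b.IsPos β) (hγ : ¬ b.IsPos γ) (h : P.root γ = P.root α + P.root β) :
    rootVar p o c n α * rootVar p o c n β -
      (c α β 1 1 • rootVar p o c n γ + rootVar p o c n β * rootVar p o c n α)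
      ∈ Fil p o c n (coxeterNumber b + b.height α + b.height β + 1) := by
  classical
  have h0 : P.root α + P.root β ≠ 0 := h ▸ P.ne_zero γ
  -- Taking `y` to be supported at the single entry (1, 1, γ) makes the sum over the list collapse,
  -- since the list has no repetitions.
  have key := pos_mul_neg_congr (o := o) (c := c) (n := n) hp α β hα hβ h0
    (fun t => if t = (1, 1, γ) then c α β 1 1 • X (.root γ) else 0) (by
      intro i j γ' ht _
      obtain ⟨hi, hj, hγ'⟩ := (o.mem_terms _ _ h0 i j γ').1 ht
      by_cases hij : i = 1 ∧ j = 1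
      · obtain ⟨rfl, rfl⟩ := hij
        have : γ' = γ := P.root.injective (by rw [hγ', h, one_smul, one_smul])
        simp [this]
      · rw [if_neg hij, if_neg]
        rintro ⟨⟩
        exact hij ⟨rfl, rfl⟩)
  have hmem : ((1, 1, γ) : ℕ × ℕ × ι) ∈ (o.terms α β).filter fun t => ¬ b.IsPos t.2.2 := by
    simp only [List.mem_filter, decide_eq_true_eq]
    exact ⟨(o.mem_terms _ _ h0 1 1 γ).2 (by simp [h]), hγ⟩
  rw [← List.sum_toFinset _ ((o.nodup_terms _ _).filter _), Finset.sum_ite_eq',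
    if_pos (List.mem_toFinset.2 hmem)] at key
  simpa only [toBbar_sub, toBbar_add, toBbar_mul, toBbar_zsmul, toBbar_root] using key

theorem pos_mul_neg_congr_of_not_neg (hp : coxeterNumber b + 1 < p) (α β : ι) (hα : b.IsPos α)
    (hβ : ¬ b.IsPos β) (h0 : P.root α + P.root β ≠ 0)
    (h : ∀ γ, P.root γ = P.root α + P.root β → b.IsPos γ) :
    rootVar p o c n α * rootVar p o c n β - rootVar p o c n β * rootVar p o c n α
      ∈ Fil p o c n (coxeterNumber b + b.height α + b.height β + 1) := by
  have key := pos_mul_neg_congr (o := o) (c := c) (n := n) hp α β hα hβ h0 (fun _ => 0) (by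
    intro i j γ ht hn
    obtain ⟨hi, hj, hγ⟩ := (o.mem_terms _ _ h0 i j γ).1 ht
    rw [if_neg]
    rintro ⟨rfl, rfl⟩
    exact hn (h γ (by rw [hγ, one_smul, one_smul])))
  rw [← toBbar_root, ← toBbar_root, ← toBbar_mul, ← toBbar_mul, ← toBbar_sub]
  simpa using key

/-- The p-adic powers of 1 + U and 1 + V have exponent 1 mod p, so they may be replaced by 1 + U and
1 + V up to degree p ≥ h + 2. The torus product contributes its linear part, of degree h. -/
theorem pos_mul_opposite_congr (hp : coxeterNumber b + 1 < p) (α β : ι) (hα : b.IsPos α)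
    (hβ : P.root β = -P.root α) :
    rootVar p o c n α * rootVar p o c n β -
      ((o.simple.map fun δ => n α δ • torusVar p o c n δ).sum +
        rootVar p o c n β * rootVar p o c n α)
      ∈ Fil p o c n (coxeterNumber b + 1) := by
  have h := toBbar_mem_Fil (IsRelation.r8 (o := o) (c := c) (n := n) (p := p) α β hα hβ)
    (x := X (.root α) * X (.root β) - ((o.simple.map fun δ =>
      n α δ • X (.torus δ)).sum + X (.root β) * X (.root α)))
    (m := coxeterNumber b + 1) ?_
  · simpa only [toBbar_sub, toBbar_add, toBbar_mul, toBbar_list_sum, toBbar_nsmul,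
      toBbar_root, toBbar_torus] using h
  simp only [map_sub, map_mul, map_add, map_one, map_X, map_list_prod, List.map_map]
  have p1 : 0 < b.height α := hα
  have q1 := height_lt_coxeterNumber b α
  have key := list_prod_sub_one_sub_sum_mem (deg := deg b) o.simple
    (⇑(map (PadicInt.toZMod (p := p))) ∘ fun δ => torusPow p b δ (n α δ : ℤ_[p]))
    (fun δ => n α δ • X (.torus δ)) (T := coxeterNumber b + 1) (by omega)
    (fun δ _ => nsmul_mem (degFil_anti (by rw [deg_torus]; omega) (X_mem_degFil _)) _)
    (fun δ _ => by
      have := map_onePlusPow_intCast_sub_mem (deg := deg b) (p := p) (.torus δ) (n α δ)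
        (T := coxeterNumber b + 1) (by rw [deg_torus]; omega) (by rw [deg_torus]; omega)
      rw [natCast_zsmul] at this
      simpa using this)
  have hpow : ∀ γ : ι, map PadicInt.toZMod (rootPow p b γ ↑(onePlusP p)⁻¹) - (1 + X (.root γ)) ∈
      degFil (deg b) (coxeterNumber b + 1) := fun γ => by
    have hd := one_le_deg_root (b := b) γ
    have hc := coxeterNumber_pos (b := b) γ
    exact map_onePlusPow_sub_one_add_X_mem _ toZMod_onePlusP_inv (by omega) (by nlinarith)
  have hU := hpow β
  have hV := hpow α
  have hA := X_root_mem (b := b) (p := p) α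
  have hB := X_root_mem (b := b) (p := p) β
  set A : ModAlg p b := X (.root α)
  set B : ModAlg p b := X (.root β)
  set S : ModAlg p b := (o.simple.map fun δ => n α δ • X (.torus δ)).sum
  set Q : ModAlg p b := (o.simple.map _).prod
  set A' : ModAlg p b := map PadicInt.toZMod (rootPow p b α ↑(onePlusP p)⁻¹)
  set B' : ModAlg p b := map PadicInt.toZMod (rootPow p b β ↑(onePlusP p)⁻¹)
  have h1 : (1 : ModAlg p b) ∈ degFil (deg b) 0 := one_mem_degFil
  have hA0 : 1 + A ∈ degFil (deg b) 0 := add_mem h1 (degFil_anti (by omega) hA)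
  have hB0 : 1 + B ∈ degFil (deg b) 0 := add_mem h1 (degFil_anti (by omega) hB)
  have hQ0 : Q ∈ degFil (deg b) 0 := by
    have := add_mem (degFil_anti (m := 0) (by omega) key.2)
      (add_mem h1 (degFil_anti (by omega) key.1))
    rwa [sub_add_cancel] at this
  have hA0' : A' ∈ degFil (deg b) 0 := by
    have := add_mem (degFil_anti (m := 0) (by omega) hV) hA0
    rwa [sub_add_cancel] at this
  -- The three factors are replaced one at a time by 1 + B, 1 + S and 1 + A; what is left over is SA
  -- + BS + BSA, of degree at least h + 1.
  have e : A * B - (S + B * A) - ((1 + A) * (1 + B) - B' * Q * A') =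
      (B' - (1 + B)) * (Q * A') + (1 + B) * ((Q - (1 + S)) * A') +
        (1 + B) * ((1 + S) * (A' - (1 + A))) + (S * A + B * (S * (1 + A))) := by
    noncomm_ring
  have hS0 : 1 + S ∈ degFil (deg b) 0 := add_mem h1 (degFil_anti (by omega) key.1)
  have hS := key.1
  rw [add_sub_cancel_right] at hS
  rw [e]
  refine add_mem (add_mem (add_mem ?_ ?_) ?_) (add_mem ?_ ?_)
  · exact mul_mem_degFil hU (mul_mem_degFil hQ0 hA0' (add_zero _).ge) (by omega)
  · exact mul_mem_degFil hB0 (mul_mem_degFil key.2 hA0' le_rfl) (by omega)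
  · exact mul_mem_degFil hB0 (mul_mem_degFil hS0 hV le_rfl) (by omega)
  · exact mul_mem_degFil hS hA le_rfl
  · exact mul_mem_degFil hB (mul_mem_degFil hS hA0 le_rfl) (by omega)

end Iwahori

open Iwahori in
theorem mainTheorem4 {ι X₁ X₂ : Type*} [Finite ι] [AddCommGroup X₁] [AddCommGroup X₂]
    (P : RootDatum ι X₁ X₂) [P.IsReduced] (b : P.Base)
    (p : ℕ) [Fact p.Prime] (hp : coxeterNumber b + 1 < p)
    (o : ProductOrder b) (c : ι → ι → ℕ → ℕ → ℤ) (n : ι → b.support → ℕ) :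
    let h := coxeterNumber b
    let ht := b.height
    let V : ι → Bbar p o c n := rootVar p o c n
    let U : ι → Bbar p o c n := rootVar p o c n
    let W : b.support → Bbar p o c n := torusVar p o c n
    -- (R-2')
    (∀ δ α, b.IsPos α → W δ * V α - V α * W δ ∈ Fil p o c n (ht α + h + 1)) ∧
    -- (R-3')
    (∀ δ β, ¬ b.IsPos β → W δ * U β - U β * W δ ∈ Fil p o c n (2 * h + ht β + 1)) ∧
    -- (R-5')
    (∀ α₁ α₂, b.IsPos α₁ → b.IsPos α₂ →
      V α₁ * V α₂ - (((o.terms α₁ α₂).map fun t => c α₁ α₂ t.1 t.2.1 • V t.2.2).sum + V α₂ * V α₁)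
        ∈ Fil p o c n (ht α₁ + ht α₂ + 1)) ∧
    -- (R-6')
    (∀ β₁ β₂, ¬ b.IsPos β₁ → ¬ b.IsPos β₂ →
      U β₁ * U β₂ - U β₂ * U β₁ ∈ Fil p o c n (2 * h + ht β₁ + ht β₂ + 1)) ∧
    -- (R-7'), when `α + β` is a negative root `γ`
    (∀ α β γ, b.IsPos α → ¬ b.IsPos β → ¬ b.IsPos γ → P.root γ = P.root α + P.root β →
      V α * U β - (c α β 1 1 • U γ + U β * V α) ∈ Fil p o c n (h + ht α + ht β + 1)) ∧
    -- (R-7'), when `α + β` is neither zero nor a negative root (the term `U_{α+β}` is then absent)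
    (∀ α β, b.IsPos α → ¬ b.IsPos β → P.root α + P.root β ≠ 0 →
      (∀ γ, P.root γ = P.root α + P.root β → b.IsPos γ) →
      V α * U β - U β * V α ∈ Fil p o c n (h + ht α + ht β + 1)) ∧
    -- (R-8')
    (∀ α β, b.IsPos α → P.root β = -P.root α →
      V α * U β - ((o.simple.map fun δ => n α δ • W δ).sum + U β * V α)
        ∈ Fil p o c n (h + 1)) := by
  intro h ht V U W
  refine ⟨fun δ α hα => ?_, fun δ β hβ => ?_, pos_mul_pos_congr, neg_mul_neg_congr hp, pos_mul_neg_congr_of_neg hp,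
    pos_mul_neg_congr_of_not_neg hp, pos_mul_opposite_congr hp⟩
  · have := torus_commutator_mem hp δ α _ (IsRelation.r2 (o := o) (c := c) (n := n) δ α hα)
    rwa [deg_pos_root hα, add_comm (coxeterNumber b)] at this
  · have := torus_commutator_mem hp δ β _ (IsRelation.r3 (o := o) (c := c) (n := n) δ β hβ)
    rwa [deg_neg_root hβ, ← add_assoc, ← two_mul] at this
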